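/- Comparison principle. Let $n$ be a dimension, $0<\lambda\le\Lambda$, and let $i,j$ range over arbitrary index sets. Let $c^{ij}\in\mathbb R$ be constants, $b^{ij}\in\mathbb R^n$ a bounded family of vectors, and $a^{ij}:\mathbb R^n\to\mathbb R$ measurable kernels with $a^{ij}(y)=a^{ij}(-y)$ and $\lambda\le a^{ij}(y)\le\Lambda$. For a function $f$ on $\mathbb R^n$ put $$ If(x)=\sup_i\inf_j\Big(c^{ij}+b^{ij}\cdot\nabla f(x)+\mathrm{p.v.}\!\int_{\mathbb R^n}\frac{f(x+y)-f(x)}{|y|^{n+1}}\,a^{ij}(y)\,dy\Big)\in[-\infty,+\infty], $$ and consider the equation $u_t-Iu=0$ in $\mathbb R^n\times[0,+\infty)$, with $I$ acting in the space variable. An upper (lower) semicontinuous function $u:\mathbb R^n\times[0,+\infty)\to\mathbb R$ is a viscosity subsolution (supersolution) of this equation if the following holds for every $C^2$ function $\varphi$ on $\mathbb R^n\times\mathbb R$, every $x\in\mathbb R^n$, $t>0$ and $r>0$: if $\varphi(x,t)=u(x,t)$ and $\varphi(y,s)\ge u(y,s)$ (resp. $\le$) for all $(y,s)$ with $|x-y|<r$,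 $t-r<s\le t$ and $s\ge0$, then the function $w$ equal to $\varphi$ in $B_r(x)\times(t-r,t+r)$ and to $u$ elsewhere satisfies $w_t(x,t)-Iw(x,t)\le0$ (resp. $\ge0$). Let $u$ be a bounded viscosity subsolution and $v$ a bounded viscosity supersolution of this equation, and assume $u(x,0)\le v(x,0)$ for every $x\in\mathbb R^n$. Then $u(x,t)\le v(x,t)$ for every $x\in\mathbb R^n$ and every $t\ge0$. -/

import Mathlib

/-- The principal value at the point `x` of `∫ (f (x + y) - f x) / |y| ^ (n + 1) * a y dy`: the limit
as `ε → 0+` of the integral over `{ε < |y|}`.  If `a` is bounded, measurable and symmetric, the limit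
exists whenever `f` is bounded and measurable and is `C²` in a neighbourhood of `x`. -/
noncomputable def pvIntegral {n : ℕ} (a : EuclideanSpace ℝ (Fin n) → ℝ)
    (f : EuclideanSpace ℝ (Fin n) → ℝ) (x : EuclideanSpace ℝ (Fin n)) : ℝ :=
  Filter.limUnder (nhdsWithin (0 : ℝ) (Set.Ioi 0)) fun ε : ℝ =>
    ∫ y in {y : EuclideanSpace ℝ (Fin n) | ε < ‖y‖}, (f (x + y) - f x) / ‖y‖ ^ (n + 1) * a y

/-- The Isaacs operator
`I f (x) = sup_i inf_j (c i j + b i j ⬝ ∇ f (x) + p.v. ∫ (f (x + y) - f x) / |y| ^ (n + 1) * a i j y dy)`.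
The supremum and the infimum are taken in the extended reals, because the family `c` is not
assumed to be bounded. -/
noncomputable def isaacsOp {n : ℕ} {ι κ : Type*} (c : ι → κ → ℝ)
    (b : ι → κ → EuclideanSpace ℝ (Fin n)) (a : ι → κ → EuclideanSpace ℝ (Fin n) → ℝ)
    (f : EuclideanSpace ℝ (Fin n) → ℝ) (x : EuclideanSpace ℝ (Fin n)) : EReal :=
  ⨆ i, ⨅ j, ((c i j + inner ℝ (b i j) (gradient f x) + pvIntegral (a i j) f x : ℝ) : EReal)

open Classical in
/-- The function equal to `φ` in `B_r(x) × (t - r, t + r)` and to `u` elsewhere. -/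
noncomputable def patch {n : ℕ} (φ u : EuclideanSpace ℝ (Fin n) × ℝ → ℝ)
    (x : EuclideanSpace ℝ (Fin n)) (t r : ℝ) : EuclideanSpace ℝ (Fin n) × ℝ → ℝ :=
  fun p => if p ∈ Metric.ball x r ×ˢ Set.Ioo (t - r) (t + r) then φ p else u p

/-- `u` is a viscosity subsolution of `u_t - I u = 0` in `ℝⁿ × [0, ∞)`.  Test functions touch at
points `(x, t)` with `t > 0`, and only the past `s ≤ t` is tested; the values of `u` at negative
times play no role.  The inequality `w_t - I w ≤ 0` is written as `w_t ≤ I w`. -/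
def IsViscositySubsolution {n : ℕ} {ι κ : Type*} (c : ι → κ → ℝ)
    (b : ι → κ → EuclideanSpace ℝ (Fin n)) (a : ι → κ → EuclideanSpace ℝ (Fin n) → ℝ)
    (u : EuclideanSpace ℝ (Fin n) × ℝ → ℝ) : Prop :=
  UpperSemicontinuousOn u (Set.univ ×ˢ Set.Ici 0) ∧
  ∀ (φ : EuclideanSpace ℝ (Fin n) × ℝ → ℝ) (x : EuclideanSpace ℝ (Fin n)) (t r : ℝ),
    ContDiff ℝ 2 φ → 0 < t → 0 < r → φ (x, t) = u (x, t) →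
    (∀ y s, dist x y < r → t - r < s → s ≤ t → 0 ≤ s → u (y, s) ≤ φ (y, s)) →
    ((deriv (fun s => patch φ u x t r (x, s)) t : ℝ) : EReal) ≤
      isaacsOp c b a (fun y => patch φ u x t r (y, t)) x

/-- `v` is a viscosity supersolution of `v_t - I v = 0` in `ℝⁿ × [0, ∞)`, with the same
conventions as for subsolutions. -/
def IsViscositySupersolution {n : ℕ} {ι κ : Type*} (c : ι → κ → ℝ)
    (b : ι → κ → EuclideanSpace ℝ (Fin n)) (a : ι → κ → EuclideanSpace ℝ (Fin n) → ℝ)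
    (v : EuclideanSpace ℝ (Fin n) × ℝ → ℝ) : Prop :=
  LowerSemicontinuousOn v (Set.univ ×ˢ Set.Ici 0) ∧
  ∀ (φ : EuclideanSpace ℝ (Fin n) × ℝ → ℝ) (x : EuclideanSpace ℝ (Fin n)) (t r : ℝ),
    ContDiff ℝ 2 φ → 0 < t → 0 < r → φ (x, t) = v (x, t) →
    (∀ y s, dist x y < r → t - r < s → s ≤ t → 0 ≤ s → φ (y, s) ≤ v (y, s)) →
    isaacsOp c b a (fun y => patch φ v x t r (y, t)) x ≤
      ((deriv (fun s => patch φ v x t r (x, s)) t : ℝ) : EReal)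

/-! The proof doubles variables, with the doubling parameter `N` kept finite. If `u - v` is positive
at `(x₀, T)`, then `u(P) - v(Q)` minus a quadratic penalty, a small logarithmic penalty at infinity
and `γ t` has a maximum. A fixed large `N` keeps both maximum times positive, because `u ≤ v`
initially (`exists_isMax_doubled`).

The operator has no dependence on `x`, so moving both points by the same `z` leaves the quadratic
penalty unchanged. Hence outside a ball of radius `r` the increments of `u` and `v` differ only by
the logarithmic penalty. Inside, the test functions contribute `2N|z|²`, whose integral against the
kernel is `O(N√r)`. The slopes `2N(x - y)` cancel and the time derivatives differ by `γ`, so `γ ≤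
O(β) + O(N√r)` (`le_of_isMax_doubled`). Since `r` is free once `N` is fixed, this is absurd for
small `β` and then small `r`. -/

open Filter Topology MeasureTheory

/-! ### The integrable weight -/

/-- A radial weight, comparable with `min (s ^ (3 / 2)) (s ^ (1 / 2))`, that is integrable against
`|y| ^ (-n - 1) dy`. -/
noncomputable def levyWeight (s : ℝ) : ℝ := if s < 1 then s * √s else √s

lemma levyWeight_of_lt {s : ℝ} (h : s < 1) : levyWeight s = s * √s := if_pos h

lemma levyWeight_of_ge {s : ℝ} (h : 1 ≤ s) : levyWeight s = √s := if_neg h.not_gt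

lemma levyWeight_nonneg {s : ℝ} (hs : 0 ≤ s) : 0 ≤ levyWeight s := by
  unfold levyWeight; split_ifs <;> positivity

/-- The factor `√r` is the gain that absorbs a large but fixed `N` on a small ball. -/
lemma sq_le_sqrt_mul_levyWeight {s r : ℝ} (hs : 0 ≤ s) (hsr : s ≤ r) (h1 : s < 1) :
    s ^ 2 ≤ √r * levyWeight s := by
  rw [levyWeight_of_lt h1]
  have h2 : √s ≤ √r := Real.sqrt_le_sqrt hsr
  nlinarith [Real.mul_self_sqrt hs, Real.sqrt_nonneg s, mul_nonneg hs (Real.sqrt_nonneg s)]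

lemma sq_le_levyWeight {s : ℝ} (hs : 0 ≤ s) (h1 : s < 1) : s ^ 2 ≤ levyWeight s := by
  simpa using sq_le_sqrt_mul_levyWeight hs h1.le h1

lemma one_le_levyWeight {s : ℝ} (h1 : 1 ≤ s) : 1 ≤ levyWeight s := by
  rw [levyWeight_of_ge h1]; exact Real.one_le_sqrt.2 h1

/-- In polar coordinates the integrand is `s ^ (-1/2)` near zero and `s ^ (-3/2)` at infinity. -/
lemma integrable_levyWeight (n : ℕ) :
    Integrable fun z : EuclideanSpace ℝ (Fin n) => levyWeight ‖z‖ / ‖z‖ ^ (n + 1) := by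
  rcases Nat.eq_zero_or_pos n with rfl | hn
  · exact Integrable.of_finite
  have : Nonempty (Fin n) := ⟨⟨0, hn⟩⟩
  refine (integrable_fun_norm_addHaar (E := EuclideanSpace ℝ (Fin n)) volume
    (f := fun s => levyWeight s / s ^ (n + 1))).2 ?_
  rw [finrank_euclideanSpace_fin, ← Set.Ioo_union_Ici_eq_Ioi zero_lt_one]
  have key : ∀ s : ℝ, 0 < s → s ^ (n - 1) • (levyWeight s / s ^ (n + 1)) = levyWeight s / s ^ 2 :=
      by
    intro s hs
    have : s ^ (n + 1) = s ^ (n - 1) * s ^ 2 := by rw [← pow_add]; congr 1; omega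
    rw [this, smul_eq_mul]; field_simp
  refine IntegrableOn.union ?_ ?_
  · have h := (intervalIntegral.integrableOn_Ioo_rpow_iff (s := -(1 / 2)) zero_lt_one).2
      (by norm_num)
    refine h.congr_fun (fun s hs => ?_) measurableSet_Ioo
    have hs0 : 0 < s := hs.1
    have h3 : 0 < √s := Real.sqrt_pos.2 hs0
    simp only
    rw [key s hs0, levyWeight_of_lt hs.2, Real.rpow_neg hs0.le, ← Real.sqrt_eq_rpow]
    field_simp
    exact (Real.sq_sqrt hs0.le).symm
  · have h := (integrableOn_Ioi_rpow_of_lt (a := -(3 / 2)) (by norm_num) zero_lt_one)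
    rw [integrableOn_Ici_iff_integrableOn_Ioi]
    refine h.congr_fun (fun s hs => ?_) measurableSet_Ioi
    have hs0 : 0 < s := zero_lt_one.trans hs
    simp only
    rw [key s hs0, levyWeight_of_ge (le_of_lt hs), Real.sqrt_eq_rpow, ← Real.rpow_natCast,
      ← Real.rpow_sub hs0]
    norm_num

/-! ### Compensated increments and comparison of the operators -/

section Increment

variable {n : ℕ}

/-- The increment of `f` at `x`, compensated in the unit ball by the slope `p`. -/
noncomputable def incr (f : EuclideanSpace ℝ (Fin n) → ℝ) (x p z : EuclideanSpace ℝ (Fin n)) : ℝ :=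
  f (x + z) - f x - if ‖z‖ < 1 then inner ℝ p z else 0

lemma incr_of_lt {f : EuclideanSpace ℝ (Fin n) → ℝ} {x p z : EuclideanSpace ℝ (Fin n)}
    (h : ‖z‖ < 1) :
    incr f x p z = f (x + z) - f x - inner ℝ p z := by simp [incr, h]

lemma incr_of_ge {f : EuclideanSpace ℝ (Fin n) → ℝ} {x p z : EuclideanSpace ℝ (Fin n)}
    (h : 1 ≤ ‖z‖) :
    incr f x p z = f (x + z) - f x := by simp [incr, h.not_gt]

lemma measurable_incr {f : EuclideanSpace ℝ (Fin n) → ℝ} (hf : Measurable f)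
    (x p : EuclideanSpace ℝ (Fin n)) : Measurable (incr f x p) := by
  unfold incr
  refine ((hf.comp (measurable_const_add x)).sub_const _).sub ?_
  exact Measurable.ite (measurableSet_lt measurable_norm measurable_const)
    (by fun_prop) measurable_const

/-- This gives integrability only: `K` may blow up as `r → 0`, and no later estimate depends on its
size. -/
lemma exists_abs_incr_le {f : EuclideanSpace ℝ (Fin n) → ℝ} {x p : EuclideanSpace ℝ (Fin n)}
    {B C r : ℝ} (hr : 0 < r) (hr1 : r ≤ 1)
    (hB : ∀ z, r ≤ ‖z‖ → |f (x + z) - f x| ≤ B)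
    (hC : ∀ z, ‖z‖ < r → |f (x + z) - f x - inner ℝ p z| ≤ C * ‖z‖ ^ 2) :
    ∃ K, ∀ z, |incr f x p z| ≤ K * levyWeight ‖z‖ := by
  -- In dimension zero `hB` is vacuous and does not force `0 ≤ B`.
  wlog hB0 : 0 ≤ B generalizing B
  · exact this (B := |B|) (fun z hz => (hB z hz).trans (le_abs_self B)) (abs_nonneg B)
  have hsr : 0 < r * √r := by positivity
  refine ⟨|C| + (B + ‖p‖) / (r * √r) + B, fun z => ?_⟩
  have hw := levyWeight_nonneg (norm_nonneg z)
  have hq : 0 ≤ (B + ‖p‖) / (r * √r) := by positivity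
  rcases lt_or_ge ‖z‖ r with h | h
  · rw [incr_of_lt (h.trans_le hr1)]
    have h2 := sq_le_levyWeight (norm_nonneg z) (h.trans_le hr1)
    calc _ ≤ C * ‖z‖ ^ 2 := hC z h
      _ ≤ |C| * ‖z‖ ^ 2 := by gcongr; exact le_abs_self C
      _ ≤ |C| * levyWeight ‖z‖ := by gcongr
      _ ≤ _ := by gcongr; linarith
  rcases lt_or_ge ‖z‖ 1 with h1 | h1
  · rw [incr_of_lt h1]
    have h2 : r * √r ≤ levyWeight ‖z‖ := by rw [levyWeight_of_lt h1]; gcongr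
    have h3 : |inner ℝ p z| ≤ ‖p‖ := (abs_real_inner_le_norm p z).trans
      (mul_le_of_le_one_right (norm_nonneg p) h1.le)
    calc _ ≤ |f (x + z) - f x| + |inner ℝ p z| := abs_sub _ _
      _ ≤ B + ‖p‖ := add_le_add (hB z h) h3
      _ = (B + ‖p‖) / (r * √r) * (r * √r) := by field_simp
      _ ≤ (B + ‖p‖) / (r * √r) * levyWeight ‖z‖ := by gcongr
      _ ≤ _ := by gcongr; linarith [abs_nonneg C]
  · rw [incr_of_ge h1]
    have h2 := one_le_levyWeight h1
    calc _ ≤ B := hB z h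
      _ ≤ B * levyWeight ‖z‖ := le_mul_of_one_le_right hB0 h2
      _ ≤ _ := by gcongr; linarith [abs_nonneg C]

/-- Near zero the weight is `|z| ^ (3/2) = o(|z|)`, which forces the slope to be the gradient. -/
lemma gradient_eq_of_abs_incr_le {f : EuclideanSpace ℝ (Fin n) → ℝ}
    {x p : EuclideanSpace ℝ (Fin n)} {K : ℝ}
    (hK : ∀ z, |incr f x p z| ≤ K * levyWeight ‖z‖) : gradient f x = p := by
  refine HasGradientAt.gradient ?_
  rw [hasGradientAt_iff_hasFDerivAt, hasFDerivAt_iff_isLittleO_nhds_zero]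
  have h1 : (fun z : EuclideanSpace ℝ (Fin n) => f (x + z) - f x - (InnerProductSpace.toDual ℝ
      (EuclideanSpace ℝ (Fin n)) p) z) =O[𝓝 0]
      fun z => ‖z‖ * √‖z‖ := by
    refine Asymptotics.IsBigO.of_bound K ?_
    filter_upwards [Metric.ball_mem_nhds (0 : EuclideanSpace ℝ (Fin n)) one_pos] with z hz
    have hz : ‖z‖ < 1 := by simpa using hz
    have := hK z
    rw [incr_of_lt hz, levyWeight_of_lt hz] at this
    rwa [InnerProductSpace.toDual_apply_apply, Real.norm_eq_abs,
      Real.norm_of_nonneg (by positivity)]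
  refine h1.trans_isLittleO ?_
  have h2 : (fun z : EuclideanSpace ℝ (Fin n) => √‖z‖) =o[𝓝 0] fun _ => (1 : ℝ) := by
    rw [Asymptotics.isLittleO_one_iff]
    have : Continuous fun z : EuclideanSpace ℝ (Fin n) => √‖z‖ := by fun_prop
    simpa using this.tendsto 0
  simpa using ((Asymptotics.isBigO_refl (fun z : EuclideanSpace ℝ (Fin n) => ‖z‖)
      (𝓝 0)).mul_isLittleO h2).trans_isBigO
    (by simpa using (Asymptotics.isBigO_norm_left.2 (Asymptotics.isBigO_refl
    (fun z : EuclideanSpace ℝ (Fin n) => z) _)))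

lemma integral_setOf_lt_norm_odd (a : EuclideanSpace ℝ (Fin n) → ℝ) (ha : ∀ y, a y = a (-y))
    (p : EuclideanSpace ℝ (Fin n)) (ε : ℝ) :
    ∫ y in {y : EuclideanSpace ℝ (Fin n) | ε < ‖y‖}, (if ‖y‖ < 1 then inner ℝ p y else 0) / ‖y‖ ^
        (n + 1) * a y = 0 := by
  have hS : MeasurableSet {y : EuclideanSpace ℝ (Fin n) | ε < ‖y‖} :=
      measurableSet_lt measurable_const measurable_norm
  rw [← integral_indicator hS]
  have h := integral_neg_eq_self ({y : EuclideanSpace ℝ (Fin n) | ε < ‖y‖}.indicator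
    fun y : EuclideanSpace ℝ (Fin n) => (if ‖y‖ < 1 then inner ℝ p y else 0) / ‖y‖ ^ (n + 1) * a y)
        volume
  have h2 : (fun y : EuclideanSpace ℝ (Fin n) => {y : EuclideanSpace ℝ (Fin n) | ε < ‖y‖}.indicator
      (fun y : EuclideanSpace ℝ (Fin n) => (if ‖y‖ < 1 then inner ℝ p y else 0) / ‖y‖ ^ (n + 1) * a
          y) (-y)) =
      fun y => -({y : EuclideanSpace ℝ (Fin n) | ε < ‖y‖}.indicator
      (fun y : EuclideanSpace ℝ (Fin n) => (if ‖y‖ < 1 then inner ℝ p y else 0) / ‖y‖ ^ (n + 1) * a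
          y) y) := by
    ext y
    by_cases hy : ε < ‖y‖ <;> by_cases hy1 : ‖y‖ < 1 <;>
      simp [Set.indicator, hy, hy1, ← ha y, neg_div]
  rw [h2, integral_neg] at h
  linarith

variable {a : EuclideanSpace ℝ (Fin n) → ℝ} {lam Lam : ℝ}

lemma integrable_of_abs_le_levyWeight (ha_meas : AEMeasurable a) (ha : ∀ y, |a y| ≤ Lam)
    {g : EuclideanSpace ℝ (Fin n) → ℝ} (hg : Measurable g) {K : ℝ} (hK : ∀ z, |g z| ≤
        K * levyWeight ‖z‖) :
    Integrable fun z : EuclideanSpace ℝ (Fin n) => g z / ‖z‖ ^ (n + 1) * a z := by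
  refine Integrable.mono' ((integrable_levyWeight n).const_mul (K * Lam)) ?_ (ae_of_all _ fun z =>
      ?_)
  · exact ((by fun_prop : Measurable fun z :
      EuclideanSpace ℝ (Fin n) => g z / ‖z‖ ^ (n + 1)).aemeasurable.mul
      ha_meas).aestronglyMeasurable
  · rw [Real.norm_eq_abs, abs_mul, abs_div, abs_of_nonneg (by positivity : 0 ≤ ‖z‖ ^ (n + 1))]
    calc _ ≤ K * levyWeight ‖z‖ / ‖z‖ ^ (n + 1) * Lam := by
          have := (abs_nonneg _).trans (hK z)
          gcongr
          exacts [hK z, ha z]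
      _ = _ := by ring

/-- The principal value is the integral of the compensated increment. -/
lemma pvIntegral_eq_integral_incr (ha_meas : AEMeasurable a) (ha_symm : ∀ y, a y = a (-y))
    (ha : ∀ y, |a y| ≤ Lam) {f : EuclideanSpace ℝ (Fin n) → ℝ} (hf : Measurable f)
    {x p : EuclideanSpace ℝ (Fin n)} {K : ℝ}
    (hK : ∀ z, |incr f x p z| ≤ K * levyWeight ‖z‖) :
    pvIntegral a f x = ∫ z, incr f x p z / ‖z‖ ^ (n + 1) * a z := by
  have hint := integrable_of_abs_le_levyWeight ha_meas ha (measurable_incr hf x p) hK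
  refine Tendsto.limUnder_eq ?_
  have h1 : Tendsto (fun ε : ℝ => ∫ z, {y : EuclideanSpace ℝ (Fin n) | ε < ‖y‖}.indicator
      (fun z => incr f x p z / ‖z‖ ^ (n + 1) * a z) z) (𝓝[>] 0)
      (𝓝 (∫ z, incr f x p z / ‖z‖ ^ (n + 1) * a z)) := by
    refine tendsto_integral_filter_of_dominated_convergence
      (fun z => |incr f x p z / ‖z‖ ^ (n + 1) * a z|) ?_ ?_ hint.abs ?_
    · exact Eventually.of_forall fun ε => hint.aestronglyMeasurable.indicator
        (measurableSet_lt measurable_const measurable_norm)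
    · exact Eventually.of_forall fun ε => ae_of_all _ fun z =>
        norm_indicator_le_norm_self _ z
    · refine ae_of_all _ fun z => ?_
      by_cases hz : z = 0
      · subst hz; simp [Set.indicator]
      · refine tendsto_const_nhds.congr' ?_
        filter_upwards [mem_nhdsWithin_of_mem_nhds (Iio_mem_nhds (norm_pos_iff.2 hz))] with ε hε
        rw [Set.indicator_of_mem]
        exact hε
  refine h1.congr' ?_
  filter_upwards [self_mem_nhdsWithin] with ε hε
  have hε : 0 < ε := hε
  have hS : MeasurableSet {y : EuclideanSpace ℝ (Fin n) | ε < ‖y‖} :=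
      measurableSet_lt measurable_const measurable_norm
  -- The linear compensator is odd, so its truncated integral vanishes and can be added for free.
  rw [integral_indicator hS, ← add_zero (∫ z in _, _), ← integral_setOf_lt_norm_odd a ha_symm p ε,
    ← integral_add hint.integrableOn]
  · refine integral_congr_ae (ae_of_all _ fun z => ?_)
    simp only [incr]; ring
  · rw [← IntegrableOn, ← integrable_indicator_iff hS]
    have h3 : Measurable fun y : EuclideanSpace ℝ (Fin n) =>
    {y : EuclideanSpace ℝ (Fin n) | ε < ‖y‖}.indicator
        (fun y => if ‖y‖ < 1 then inner ℝ p y else 0) y :=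
      (Measurable.ite (measurableSet_lt measurable_norm measurable_const)
        (by fun_prop) measurable_const).indicator hS
    -- On `ε < |z| < 1` the linear term is at most `‖p‖ |z| ≤ (‖p‖ / ε) |z|²`.
    refine (integrable_of_abs_le_levyWeight ha_meas ha h3 (K := ‖p‖ / ε) fun z => ?_).congr
      (ae_of_all _ fun z => ?_)
    · have hw := levyWeight_nonneg (norm_nonneg z)
      by_cases hz : ε < ‖z‖ <;> by_cases hz1 : ‖z‖ < 1
      · simp only [Set.indicator, Set.mem_ofPred_eq, hz, hz1, if_true]
        calc _ ≤ ‖p‖ * ‖z‖ := abs_real_inner_le_norm p z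
          _ = ‖p‖ / ε * (ε * ‖z‖) := by field_simp
          _ ≤ ‖p‖ / ε * ‖z‖ ^ 2 := by rw [sq]; gcongr
          _ ≤ _ := by gcongr; exact sq_le_levyWeight (norm_nonneg z) hz1
      all_goals simp only [Set.indicator, Set.mem_ofPred_eq, hz, hz1, if_true, if_false, abs_zero]
                positivity
    · by_cases hz : ε < ‖z‖ <;> simp [Set.indicator, hz]

/-- Both points see the same kernel, so the increments are compared at equal `z`; positivity of `a`
makes a one-sided bound enough. -/
lemma pvIntegral_sub_le (ha_meas : AEMeasurable a) (ha_symm : ∀ y, a y = a (-y))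
    (ha0 : ∀ y, 0 ≤ a y) (ha : ∀ y, a y ≤ Lam) {f g : EuclideanSpace ℝ (Fin n) → ℝ}
    (hf : Measurable f)
    (hg : Measurable g) {x y p q : EuclideanSpace ℝ (Fin n)} {K K' η : ℝ} (hη : 0 ≤ η)
    (hK : ∀ z, |incr f x p z| ≤ K * levyWeight ‖z‖)
    (hK' : ∀ z, |incr g y q z| ≤ K' * levyWeight ‖z‖)
    (h : ∀ z, incr f x p z - incr g y q z ≤ η * levyWeight ‖z‖) :
    pvIntegral a f x - pvIntegral a g y ≤
      η * (Lam * ∫ z : EuclideanSpace ℝ (Fin n), levyWeight ‖z‖ / ‖z‖ ^ (n + 1)) := by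
  have ha' : ∀ y, |a y| ≤ Lam := fun y => (abs_of_nonneg (ha0 y)).trans_le (ha y)
  rw [pvIntegral_eq_integral_incr ha_meas ha_symm ha' hf hK,
    pvIntegral_eq_integral_incr ha_meas ha_symm ha' hg hK', ← integral_sub
      (integrable_of_abs_le_levyWeight ha_meas ha' (measurable_incr hf x p) hK)
      (integrable_of_abs_le_levyWeight ha_meas ha' (measurable_incr hg y q) hK'),
    ← integral_const_mul, ← integral_const_mul]
  refine integral_mono
    ((integrable_of_abs_le_levyWeight ha_meas ha' (measurable_incr hf x p) hK).sub
      (integrable_of_abs_le_levyWeight ha_meas ha' (measurable_incr hg y q) hK'))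
    (((integrable_levyWeight n).const_mul _).const_mul _) fun z => ?_
  have hw := levyWeight_nonneg (norm_nonneg z)
  calc _ = (incr f x p z - incr g y q z) / ‖z‖ ^ (n + 1) * a z := by ring
    _ ≤ η * levyWeight ‖z‖ / ‖z‖ ^ (n + 1) * a z := by
        have := ha0 z
        gcongr; exact h z
    _ ≤ η * levyWeight ‖z‖ / ‖z‖ ^ (n + 1) * Lam := by gcongr; exact ha z
    _ = _ := by ring

/-- The constants `c i j` cancel index by index, and the remaining bound is uniform in `i, j`, so it
passes through the sup-inf even when that is infinite. -/
lemma isaacsOp_le_add {ι κ : Type*} {A : ℝ} {c : ι → κ → ℝ} {b : ι → κ → EuclideanSpace ℝ (Fin n)}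
    (hb : ∀ i j, ‖b i j‖ ≤ A) {a : ι → κ → EuclideanSpace ℝ (Fin n) → ℝ}
    (ha_meas : ∀ i j, AEMeasurable (a i j))
    (ha_symm : ∀ i j y, a i j y = a i j (-y)) (ha0 : ∀ i j y, 0 ≤ a i j y)
    (ha : ∀ i j y, a i j y ≤ Lam) {f g : EuclideanSpace ℝ (Fin n) → ℝ} (hf : Measurable f)
    (hg : Measurable g) {x y p q : EuclideanSpace ℝ (Fin n)} {K K' η : ℝ} (hη : 0 ≤ η)
    (hK : ∀ z, |incr f x p z| ≤ K * levyWeight ‖z‖)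
    (hK' : ∀ z, |incr g y q z| ≤ K' * levyWeight ‖z‖)
    (h : ∀ z, incr f x p z - incr g y q z ≤ η * levyWeight ‖z‖) :
    isaacsOp c b a f x ≤ isaacsOp c b a g y +
      ((|A| * ‖p - q‖ + η * (Lam * ∫ z :
          EuclideanSpace ℝ (Fin n), levyWeight ‖z‖ / ‖z‖ ^ (n + 1)) : ℝ) : EReal) := by
  set D : ℝ := |A| * ‖p - q‖ + η * (Lam * ∫ z :
      EuclideanSpace ℝ (Fin n), levyWeight ‖z‖ / ‖z‖ ^ (n + 1))
  refine iSup_le fun i => ?_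
  refine le_trans ?_ (add_le_add_left (le_iSup _ i) _)
  rw [← EReal.sub_le_iff_le_add (.inl (EReal.coe_ne_bot _)) (.inl (EReal.coe_ne_top _))]
  refine le_iInf fun j => ?_
  rw [EReal.sub_le_iff_le_add (.inl (EReal.coe_ne_bot _)) (.inl (EReal.coe_ne_top _))]
  refine (iInf_le _ j).trans ?_
  rw [← EReal.coe_add, EReal.coe_le_coe_iff, gradient_eq_of_abs_incr_le hK,
    gradient_eq_of_abs_incr_le hK']
  have h1 := pvIntegral_sub_le (ha_meas i j) (ha_symm i j) (ha0 i j) (ha i j) hf hg hη hK hK' h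
  have h2 : inner ℝ (b i j) p - inner ℝ (b i j) q ≤ |A| * ‖p - q‖ := by
    rw [← inner_sub_right]
    refine (real_inner_le_norm _ _).trans ?_
    gcongr
    exact (hb i j).trans (le_abs_self A)
  linarith

end Increment

/-! ### The logarithmic penalty -/

section LogPenalty

variable {V : Type*} [NormedAddCommGroup V]

/-- A smooth coercive function whose nonlocal increments are bounded. -/
noncomputable def logPenalty (x : V) : ℝ := Real.log (1 + ‖x‖ ^ 2)

lemma logPenalty_nonneg (x : V) : 0 ≤ logPenalty x :=
  Real.log_nonneg (by nlinarith [sq_nonneg ‖x‖])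

/-- The square root matches the weight outside the unit ball. The constant does not depend on `x`,
so a small multiple of the penalty costs little wherever the maximum lies. -/
lemma logPenalty_add_sub_le_sqrt (x z : V) :
    logPenalty (x + z) - logPenalty x ≤ 4 * √‖z‖ := by
  have hP0 : 0 < 1 + ‖x‖ ^ 2 := by positivity
  have hQ : 0 < 1 + ‖x + z‖ ^ 2 := by positivity
  have h0 := norm_nonneg z
  have h1 : (1 + ‖x + z‖ ^ 2) / (1 + ‖x‖ ^ 2) ≤ (1 + √‖z‖) ^ 4 := by
    rw [div_le_iff₀ hP0]
    have h2 : ‖x + z‖ ^ 2 ≤ (‖x‖ + ‖z‖) ^ 2 := by gcongr; exact norm_add_le x z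
    have h3 : 1 + ‖z‖ ≤ (1 + √‖z‖) ^ 2 := by
      nlinarith [Real.sq_sqrt h0, Real.sqrt_nonneg ‖z‖]
    have h4 : (1 + ‖z‖) ^ 2 ≤ (1 + √‖z‖) ^ 4 := by
      calc _ ≤ ((1 + √‖z‖) ^ 2) ^ 2 := by gcongr
        _ = _ := by ring
    calc _ ≤ (1 + ‖z‖) ^ 2 * (1 + ‖x‖ ^ 2) := by
          nlinarith [mul_nonneg h0 (sq_nonneg (‖x‖ - 1)), mul_nonneg (sq_nonneg ‖z‖)
              (sq_nonneg ‖x‖)]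
      _ ≤ _ := by gcongr
  have h5 := Real.log_le_log (div_pos hQ hP0) h1
  rw [Real.log_div hQ.ne' hP0.ne', Real.log_pow] at h5
  have h6 := Real.log_le_sub_one_of_pos (by positivity : 0 < 1 + √‖z‖)
  simp only [logPenalty]
  push_cast at h5
  linarith

/-- The gradient of `logPenalty`. -/
noncomputable def logPenaltyGrad [NormedSpace ℝ V] (x : V) : V := (2 / (1 + ‖x‖ ^ 2)) • x

variable [InnerProductSpace ℝ V]

lemma contDiff_logPenalty : ContDiff ℝ 2 (logPenalty : V → ℝ) :=
  (contDiff_const.add (contDiff_norm_sq ℝ)).log fun x => by positivity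

lemma norm_logPenaltyGrad_le (x : V) : ‖logPenaltyGrad x‖ ≤ 1 := by
  rw [logPenaltyGrad, norm_smul, Real.norm_of_nonneg (by positivity), div_mul_eq_mul_div,
    div_le_one (by positivity)]
  nlinarith [sq_nonneg (‖x‖ - 1)]

/-- From `log q - log p ≤ q / p - 1`; again the constant is uniform in `x`. -/
lemma logPenalty_add_sub_le (x z : V) :
    logPenalty (x + z) - logPenalty x - inner ℝ (logPenaltyGrad x) z ≤ ‖z‖ ^ 2 := by
  have hP : 1 ≤ 1 + ‖x‖ ^ 2 := by nlinarith [sq_nonneg ‖x‖]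
  have hP0 : 0 < 1 + ‖x‖ ^ 2 := by linarith
  have hQ : 0 < 1 + ‖x + z‖ ^ 2 := by positivity
  have h := Real.log_le_sub_one_of_pos (div_pos hQ hP0)
  rw [Real.log_div hQ.ne' hP0.ne'] at h
  have h2 : (1 + ‖x + z‖ ^ 2) / (1 + ‖x‖ ^ 2) - 1 - inner ℝ (logPenaltyGrad x) z =
      ‖z‖ ^ 2 / (1 + ‖x‖ ^ 2) := by
    rw [logPenaltyGrad, real_inner_smul_left, norm_add_sq_real]; field_simp; ring
  have h3 : ‖z‖ ^ 2 / (1 + ‖x‖ ^ 2) ≤ ‖z‖ ^ 2 := div_le_self (by positivity) hP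
  simp only [logPenalty]; linarith

/-- The same logarithm inequality with the two arguments exchanged leaves a product of two
first-order terms. The constant depends on `x`, which is harmless: it serves only for integrability.
-/
lemma neg_le_logPenalty_add_sub {x z : V} (hz : ‖z‖ < 1) :
    -(2 * ‖x‖ + 1) * ‖z‖ ^ 2 ≤
      logPenalty (x + z) - logPenalty x - inner ℝ (logPenaltyGrad x) z := by
  have hP0 : 0 < 1 + ‖x‖ ^ 2 := by positivity
  have hQ : 0 < 1 + ‖x + z‖ ^ 2 := by positivity
  have hQ1 : 1 ≤ 1 + ‖x + z‖ ^ 2 := by nlinarith [sq_nonneg ‖x + z‖]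
  have h := Real.log_le_sub_one_of_pos (div_pos hP0 hQ)
  rw [Real.log_div hP0.ne' hQ.ne'] at h
  have hg : |inner ℝ (logPenaltyGrad x) z| ≤ ‖z‖ := (abs_real_inner_le_norm _ _).trans
    (mul_le_of_le_one_left (norm_nonneg z) (norm_logPenaltyGrad_le x))
  have hd : |‖x + z‖ ^ 2 - ‖x‖ ^ 2| ≤ (2 * ‖x‖ + 1) * ‖z‖ := by
    have h1 := abs_real_inner_le_norm x z
    rw [norm_add_sq_real, abs_le]
    rw [abs_le] at h1
    constructor <;> nlinarith [norm_nonneg z, norm_nonneg x]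
  have h2 : 1 - (1 + ‖x‖ ^ 2) / (1 + ‖x + z‖ ^ 2) - inner ℝ (logPenaltyGrad x) z =
      (‖z‖ ^ 2 - inner ℝ (logPenaltyGrad x) z * (‖x + z‖ ^ 2 - ‖x‖ ^ 2)) /
        (1 + ‖x + z‖ ^ 2) := by
    rw [logPenaltyGrad, real_inner_smul_left, norm_add_sq_real] at *; field_simp; ring
  have h3 : |inner ℝ (logPenaltyGrad x) z * (‖x + z‖ ^ 2 - ‖x‖ ^ 2)| ≤
      ‖z‖ * ((2 * ‖x‖ + 1) * ‖z‖) := by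
    rw [abs_mul]; gcongr
  have h4 : -((2 * ‖x‖ + 1) * ‖z‖ ^ 2) ≤
      (‖z‖ ^ 2 - inner ℝ (logPenaltyGrad x) z * (‖x + z‖ ^ 2 - ‖x‖ ^ 2)) /
        (1 + ‖x + z‖ ^ 2) := by
    rw [le_div_iff₀ hQ]
    have h5 : 0 ≤ (2 * ‖x‖ + 1) * ‖z‖ ^ 2 := by positivity
    nlinarith [(abs_le.1 h3).2, sq_nonneg ‖z‖, mul_le_mul_of_nonneg_left hQ1 h5]
  simp only [logPenalty]; linarith

end LogPenalty

/-! ### Penalization on compact sets -/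

/-- Penalizing an upper semicontinuous function on a compact set by a large multiple of `d ≥ 0`
pushes it below any level that it does not reach on the zero set of `d`. -/
lemma UpperSemicontinuousOn.exists_forall_sub_mul_lt {X : Type*} [PseudoMetricSpace X] {S : Set X}
    (hS : IsCompact S) {F d : X → ℝ} (hF : UpperSemicontinuousOn F S) (hd : Continuous d)
    (hd0 : ∀ x, 0 ≤ d x) {m : ℝ} (h : ∀ x ∈ S, d x = 0 → F x < m) :
    ∃ N : ℝ, 1 ≤ N ∧ ∀ x ∈ S, F x - N * d x < m := by
  by_contra! hcon
  obtain ⟨B, hB⟩ := hF.bddAbove_of_isCompact hS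
  have hcon' : ∀ k : ℕ, ∃ x ∈ S, m ≤ F x - ((k : ℝ) + 1) * d x := fun k =>
    hcon _ (le_add_of_nonneg_left k.cast_nonneg)
  choose x hxS hx using hcon'
  obtain ⟨y, hyS, φ, hφ, hy⟩ := hS.tendsto_subseq hxS
  have hdx : ∀ k, d (x k) ≤ (B - m) * (1 / ((k : ℝ) + 1)) := fun k => by
    have h1 : F (x k) ≤ B := hB ⟨x k, hxS k, rfl⟩
    rw [mul_one_div, le_div_iff₀ (by positivity)]
    linarith [hx k]
  have hd1 : Tendsto (fun k => d (x k)) atTop (𝓝 0) := by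
    refine squeeze_zero (fun k => hd0 _) hdx ?_
    simpa using (tendsto_one_div_add_atTop_nhds_zero_nat (𝕜 := ℝ)).const_mul (B - m)
  have hdy : d y = 0 := tendsto_nhds_unique ((hd.tendsto y).comp hy) (hd1.comp hφ.tendsto_atTop)
  have hev := hF y hyS m (h y hyS hdy)
  have hy' : Tendsto (x ∘ φ) atTop (𝓝[S] y) :=
    tendsto_nhdsWithin_iff.2 ⟨hy, Eventually.of_forall fun k => hxS _⟩
  obtain ⟨k, hk⟩ := (hy'.eventually hev).exists
  have h2 := hx (φ k)
  have : 0 ≤ ((φ k : ℝ) + 1) * d (x (φ k)) := mul_nonneg (by positivity) (hd0 _)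
  simp only [Function.comp] at hk
  linarith

/-! ### Patched test functions -/

section Patch

variable {n : ℕ} {φ u : EuclideanSpace ℝ (Fin n) × ℝ → ℝ} {x : EuclideanSpace ℝ (Fin n)} {t r : ℝ}

lemma patch_of_lt (hr : 0 < r) {z : EuclideanSpace ℝ (Fin n)} (hz : ‖z‖ < r) :
    patch φ u x t r (x + z, t) = φ (x + z, t) := by
  simp [patch, hz, hr]

lemma patch_of_ge {z : EuclideanSpace ℝ (Fin n)} (hz : r ≤ ‖z‖) :
    patch φ u x t r (x + z, t) = u (x + z, t) := by
  simp [patch, hz.not_gt]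

lemma patch_self (h : φ (x, t) = u (x, t)) : patch φ u x t r (x, t) = u (x, t) := by
  simp only [patch]; split_ifs <;> simp [h]

lemma deriv_patch (hr : 0 < r) :
    deriv (fun s => patch φ u x t r (x, s)) t = deriv (fun s => φ (x, s)) t := by
  refine EventuallyEq.deriv_eq ?_
  filter_upwards [Ioo_mem_nhds (sub_lt_self t hr) (lt_add_of_pos_right t hr)] with s hs
  simp [patch, hr, hs.1, hs.2]

lemma measurable_patch (hφ : Continuous φ) (hu : Measurable fun y => u (y, t)) :
    Measurable fun y => patch φ u x t r (y, t) := by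
  classical
  unfold patch
  refine Measurable.ite ?_ (by fun_prop) hu
  exact (measurableSet_ball.prod measurableSet_Ioo).preimage (by fun_prop)

end Patch

/-! ### Existence of the maximum point -/

section Doubling

variable {n : ℕ} {u v : EuclideanSpace ℝ (Fin n) × ℝ → ℝ}

/-- The function of two space-time points whose maximum is studied in the doubling argument. -/
noncomputable def doubled (u v : EuclideanSpace ℝ (Fin n) × ℝ → ℝ) (N β γ : ℝ)
    (x₀ : EuclideanSpace ℝ (Fin n)) (P Q : EuclideanSpace ℝ (Fin n) × ℝ) : ℝ :=
  u P - v Q - N * (‖P.1 - Q.1‖ ^ 2 + (P.2 - Q.2) ^ 2) - β * logPenalty (P.1 - x₀) - γ * P.2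

lemma upperSemicontinuousOn_sub
    (hu : UpperSemicontinuousOn u (Set.univ ×ˢ Set.Ici 0))
    (hv : LowerSemicontinuousOn v (Set.univ ×ˢ Set.Ici 0)) :
    UpperSemicontinuousOn (fun X : (EuclideanSpace ℝ (Fin n) × ℝ) ×
      (EuclideanSpace ℝ (Fin n) × ℝ) => u X.1 - v X.2)
      ((Set.univ ×ˢ Set.Ici 0) ×ˢ (Set.univ ×ˢ Set.Ici 0)) := by
  have hv' : UpperSemicontinuousOn (fun P => -v P) (Set.univ ×ˢ Set.Ici 0) := fun P hP y hy =>
    (hv P hP (-y) (neg_lt.1 hy)).mono fun _ h => neg_lt.1 h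
  simp only [sub_eq_add_neg]
  exact (hu.comp continuous_fst.continuousOn fun _ h => h.1).add
    (hv'.comp continuous_snd.continuousOn fun _ h => h.2)

lemma exists_isMax_doubled
    (hu : UpperSemicontinuousOn u (Set.univ ×ˢ Set.Ici 0))
    (hv : LowerSemicontinuousOn v (Set.univ ×ˢ Set.Ici 0)) {C : ℝ}
    (huC : ∀ x t, 0 ≤ t → |u (x, t)| ≤ C) (hvC : ∀ x t, 0 ≤ t → |v (x, t)| ≤ C)
    (h0 : ∀ x, u (x, 0) ≤ v (x, 0)) {x₀ : EuclideanSpace ℝ (Fin n)} {T β γ : ℝ} (hT : 0 ≤ T)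
    (hβ : 0 < β) (hγ : 0 ≤ γ) (hlt : γ * T < u (x₀, T) - v (x₀, T)) :
    ∃ N : ℝ, 1 ≤ N ∧ ∃ P Q : EuclideanSpace ℝ (Fin n) × ℝ, P.2 ∈ Set.Ioc 0 T ∧ Q.2 ∈ Set.Ioc 0 T ∧
      ∀ P' Q' : EuclideanSpace ℝ (Fin n) × ℝ, P'.2 ∈ Set.Icc 0 T → Q'.2 ∈ Set.Icc 0 T →
        doubled u v N β γ x₀ P' Q' ≤ doubled u v N β γ x₀ P Q := by
  have hC : 0 ≤ C := (abs_nonneg _).trans (huC x₀ T hT)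
  -- Beyond `ρ` the logarithmic penalty is at least `2C`, an upper bound for `u - v`. In the second
  -- ball below, the margin `2C + 1` makes the quadratic penalty exceed `2C` when only `Q` leaves.
  set ρ : ℝ := Real.exp (2 * C / β) with hρ
  have hρ1 : 1 ≤ ρ := Real.one_le_exp (by positivity)
  set K : Set ((EuclideanSpace ℝ (Fin n) × ℝ) × (EuclideanSpace ℝ (Fin n) × ℝ)) :=
    (Metric.closedBall x₀ ρ ×ˢ Set.Icc 0 T) ×ˢ
      (Metric.closedBall x₀ (ρ + 2 * C + 1) ×ˢ Set.Icc 0 T) with hKdef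
  have hK : IsCompact K := ((isCompact_closedBall _ _).prod isCompact_Icc).prod
    ((isCompact_closedBall _ _).prod isCompact_Icc)
  set d : (EuclideanSpace ℝ (Fin n) × ℝ) × (EuclideanSpace ℝ (Fin n) × ℝ) → ℝ :=
    fun X => ‖X.1.1 - X.2.1‖ ^ 2 + (X.1.2 - X.2.2) ^ 2 with hd
  have hdc : Continuous d := by fun_prop
  have hd0 : ∀ X, 0 ≤ d X := fun X => by positivity
  have hF := (upperSemicontinuousOn_sub hu hv).mono
    (show K ⊆ _ from fun X hX => ⟨⟨trivial, hX.1.2.1⟩, ⟨trivial, hX.2.2.1⟩⟩)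
  -- On `S` the zero set of `d` is the initial diagonal, where `u - v ≤ 0 < m`; a large `N`
  -- therefore excludes maxima on `S`.
  set S := K ∩ {X | X.1.2 = 0 ∨ X.2.2 = 0} with hSdef
  have hS : IsCompact S := hK.inter_right
    ((isClosed_eq (by fun_prop) continuous_const).union (isClosed_eq (by fun_prop)
        continuous_const))
  set m := u (x₀, T) - v (x₀, T) - γ * T with hm
  have hm0 : 0 < m := sub_pos.2 hlt
  obtain ⟨N, hN, hNS⟩ := (hF.mono Set.inter_subset_left).exists_forall_sub_mul_lt hS hdc hd0
    (m := m) (by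
      rintro ⟨⟨x, t⟩, ⟨y, s⟩⟩ ⟨-, hts⟩ hdX
      have h1 : ‖x - y‖ ^ 2 = 0 := by
        simp only [hd] at hdX; nlinarith [sq_nonneg ‖x - y‖, sq_nonneg (t - s)]
      have h2 : (t - s) ^ 2 = 0 := by
        simp only [hd] at hdX; nlinarith [sq_nonneg ‖x - y‖, sq_nonneg (t - s)]
      have hxy : x = y := by simpa [sub_eq_zero] using h1
      have hst : t = s := by simpa [sub_eq_zero] using h2
      subst hxy hst
      have ht : t = 0 := by simpa using hts
      subst ht
      simpa using lt_of_le_of_lt (sub_nonpos.2 (h0 x)) hm0)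
  have hG : UpperSemicontinuousOn (fun X => doubled u v N β γ x₀ X.1 X.2) K := by
    have hc : Continuous fun X : (EuclideanSpace ℝ (Fin n) × ℝ) × (EuclideanSpace ℝ (Fin n) × ℝ) =>
        -(N * d X) - β * logPenalty (X.1.1 - x₀) - γ * X.1.2 := by
      have := (contDiff_logPenalty (V := EuclideanSpace ℝ (Fin n))).continuous
      fun_prop
    have heq : (fun X => doubled u v N β γ x₀ X.1 X.2) = fun X => u X.1 - v X.2 +
        (-(N * d X) - β * logPenalty (X.1.1 - x₀) - γ * X.1.2) := by
      ext X; simp only [doubled, hd]; ring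
    rw [heq]
    exact hF.add hc.continuousOn.upperSemicontinuousOn
  have hX₀ : (((x₀, T), (x₀, T)) :
      (EuclideanSpace ℝ (Fin n) × ℝ) × (EuclideanSpace ℝ (Fin n) × ℝ)) ∈ K := by
    simp only [hKdef, Set.mem_prod, Metric.mem_closedBall, dist_self, Set.mem_Icc]
    refine ⟨⟨by linarith, hT, le_rfl⟩, by linarith, hT, le_rfl⟩
  have hval : doubled u v N β γ x₀ (x₀, T) (x₀, T) = m := by
    simp [doubled, logPenalty, hm]
  obtain ⟨⟨P, Q⟩, hPQ, hmax⟩ := hG.exists_isMaxOn ⟨_, hX₀⟩ hK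
  have hmPQ : m ≤ doubled u v N β γ x₀ P Q := hval ▸ hmax hX₀
  have hnotS : (P, Q) ∉ S := fun h => by
    have h1 := hNS _ h
    have h2 := mul_nonneg hβ.le (logPenalty_nonneg (P.1 - x₀))
    have h3 := mul_nonneg hγ hPQ.1.2.1
    simp only [doubled, hd] at hmPQ h1
    linarith
  have hne : ¬ (P.2 = 0 ∨ Q.2 = 0) := fun h => hnotS ⟨hPQ, h⟩
  push Not at hne
  refine ⟨N, hN, P, Q, ⟨hPQ.1.2.1.lt_of_ne' hne.1, hPQ.1.2.2⟩,
    ⟨hPQ.2.2.1.lt_of_ne' hne.2, hPQ.2.2.2⟩, fun P' Q' hP' hQ' => ?_⟩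
  by_cases hmem : (P', Q') ∈ K
  · exact hmax hmem
  -- Outside `K` the doubled function is at most zero, below the maximum over `K`.
  refine le_trans ?_ (hm0.le.trans hmPQ)
  have hb : u P' - v Q' ≤ 2 * C := by
    have h1 := (abs_le.1 (huC P'.1 P'.2 hP'.1)).2
    have h2 := (abs_le.1 (hvC Q'.1 Q'.2 hQ'.1)).1
    simp only [Prod.mk.eta] at h1 h2
    linarith
  have h2 := mul_nonneg hβ.le (logPenalty_nonneg (P'.1 - x₀))
  have h3 := mul_nonneg hγ hP'.1
  have h4 : ‖P'.1 - Q'.1‖ ^ 2 ≤ N * (‖P'.1 - Q'.1‖ ^ 2 + (P'.2 - Q'.2) ^ 2) := by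
    nlinarith [sq_nonneg ‖P'.1 - Q'.1‖, sq_nonneg (P'.2 - Q'.2)]
  by_cases h5 : ‖P'.1 - x₀‖ ≤ ρ
  · have h6 : ρ + 2 * C + 1 < ‖Q'.1 - x₀‖ := by
      by_contra! h6
      exact hmem ⟨⟨by rwa [Metric.mem_closedBall, dist_eq_norm], hP'⟩,
        ⟨by rwa [Metric.mem_closedBall, dist_eq_norm], hQ'⟩⟩
    have h7 : 2 * C + 1 < ‖P'.1 - Q'.1‖ := by
      have := norm_sub_le_norm_sub_add_norm_sub Q'.1 P'.1 x₀
      rw [norm_sub_rev Q'.1 P'.1] at this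
      linarith
    simp only [doubled]
    nlinarith
  · push Not at h5
    have h6 : 2 * C ≤ β * logPenalty (P'.1 - x₀) := by
      rw [← div_le_iff₀' hβ, logPenalty, Real.le_log_iff_exp_le (by positivity), ← hρ]
      nlinarith
    simp only [doubled]
    nlinarith [sq_nonneg ‖P'.1 - Q'.1‖]

end Doubling

lemma UpperSemicontinuousOn.measurable_slice {n : ℕ} {u : EuclideanSpace ℝ (Fin n) × ℝ → ℝ}
    (hu : UpperSemicontinuousOn u (Set.univ ×ˢ Set.Ici 0)) {t : ℝ} (ht : 0 ≤ t) :
    Measurable fun y => u (y, t) :=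
  (upperSemicontinuousOn_univ_iff.1 (hu.comp (g := fun y => (y, t)) (by fun_prop)
    fun _ _ => ⟨trivial, ht⟩)).measurable

lemma LowerSemicontinuousOn.measurable_slice {n : ℕ} {u : EuclideanSpace ℝ (Fin n) × ℝ → ℝ}
    (hu : LowerSemicontinuousOn u (Set.univ ×ˢ Set.Ici 0)) {t : ℝ} (ht : 0 ≤ t) :
    Measurable fun y => u (y, t) :=
  (lowerSemicontinuousOn_univ_iff.1 (hu.comp (g := fun y => (y, t)) (by fun_prop)
    fun _ _ => ⟨trivial, ht⟩)).measurable

/-! ### The two equations at the maximum point -/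

section Comparison

variable {n : ℕ} {ι κ : Type*} {c : ι → κ → ℝ} {b : ι → κ → EuclideanSpace ℝ (Fin n)}
  {a : ι → κ → EuclideanSpace ℝ (Fin n) → ℝ} {u v : EuclideanSpace ℝ (Fin n) × ℝ → ℝ}

/-- At a maximum point of the doubled function the equations for `u` and `v` can be compared. -/
lemma le_of_isMax_doubled {Lam A : ℝ} (hb : ∀ i j, ‖b i j‖ ≤ A)
    (ha_meas : ∀ i j, AEMeasurable (a i j)) (ha_symm : ∀ i j y, a i j y = a i j (-y))
    (ha0 : ∀ i j y, 0 ≤ a i j y) (ha : ∀ i j y, a i j y ≤ Lam)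
    (hu : IsViscositySubsolution c b a u) (hv : IsViscositySupersolution c b a v) {C : ℝ}
    (huC : ∀ x t, 0 ≤ t → |u (x, t)| ≤ C) (hvC : ∀ x t, 0 ≤ t → |v (x, t)| ≤ C)
    {x₀ : EuclideanSpace ℝ (Fin n)} {T N β γ σ : ℝ} (hN : 0 ≤ N) (hβ : 0 ≤ β)
    (hσ : 0 < σ) (hσ1 : σ ≤ 1) {P Q : EuclideanSpace ℝ (Fin n) × ℝ}
    (hP : P.2 ∈ Set.Ioc 0 T) (hQ : Q.2 ∈ Set.Ioc 0 T)
    (hmax : ∀ P' Q' : EuclideanSpace ℝ (Fin n) × ℝ, P'.2 ∈ Set.Icc 0 T → Q'.2 ∈ Set.Icc 0 T →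
        doubled u v N β γ x₀ P' Q' ≤ doubled u v N β γ x₀ P Q) :
    γ ≤ |A| * β + (2 * N * σ + 4 * β) *
      (Lam * ∫ z : EuclideanSpace ℝ (Fin n), levyWeight ‖z‖ / ‖z‖ ^ (n + 1)) := by
  obtain ⟨x, t⟩ := P
  obtain ⟨y, s⟩ := Q
  obtain ⟨ht, htT⟩ := hP
  obtain ⟨hs, hsT⟩ := hQ
  dsimp only at ht htT hs hsT
  set r : ℝ := σ ^ 2 with hr
  have hr0 : 0 < r := by positivity
  have hr1 : r ≤ 1 := pow_le_one₀ hσ.le hσ1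
  have hsqrt : √r = σ := Real.sqrt_sq hσ.le
  set G : EuclideanSpace ℝ (Fin n) × ℝ → ℝ := fun q =>
    N * (‖q.1 - y‖ ^ 2 + (q.2 - s) ^ 2) + β * logPenalty (q.1 - x₀) + γ * q.2 with hG
  set H : EuclideanSpace ℝ (Fin n) × ℝ → ℝ := fun q =>
    N * (‖x - q.1‖ ^ 2 + (t - q.2) ^ 2) with hH
  set φ : EuclideanSpace ℝ (Fin n) × ℝ → ℝ := fun q => G q + (u (x, t) - G (x, t)) with hφ
  set χ : EuclideanSpace ℝ (Fin n) × ℝ → ℝ := fun q => -H q + (v (y, s) + H (y, s)) with hχ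
  have hφc : ContDiff ℝ 2 φ := by
    have h1 : ContDiff ℝ 2 fun q : EuclideanSpace ℝ (Fin n) × ℝ => ‖q.1 - y‖ ^ 2 :=
      (contDiff_fst.sub contDiff_const).norm_sq ℝ
    have h2 : ContDiff ℝ 2 fun q : EuclideanSpace ℝ (Fin n) × ℝ => logPenalty (q.1 - x₀) :=
      contDiff_logPenalty.comp (contDiff_fst.sub contDiff_const)
    fun_prop
  have hχc : ContDiff ℝ 2 χ := by
    have h1 : ContDiff ℝ 2 fun q : EuclideanSpace ℝ (Fin n) × ℝ => ‖x - q.1‖ ^ 2 :=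
      (contDiff_const.sub contDiff_fst).norm_sq ℝ
    fun_prop
  have hφP : φ (x, t) = u (x, t) := by simp [hφ]
  have hχQ : χ (y, s) = v (y, s) := by simp [hχ]
  -- Testing only the past keeps `s' ≤ T`, so the maximum property applies even when `t = T`.
  have hsub := hu.2 φ x t r hφc ht hr0 hφP fun y' s' _ _ hs't hs' => by
    have := hmax (y', s') (y, s) ⟨hs', hs't.trans htT⟩ ⟨hs.le, hsT⟩
    simp only [doubled] at this
    simp only [hφ, hG]
    linarith
  have hsup := hv.2 χ y s r hχc hs hr0 hχQ fun y' s' _ _ hs's hs' => by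
    have := hmax (x, t) (y', s') ⟨ht.le, htT⟩ ⟨hs', hs's.trans hsT⟩
    simp only [doubled] at this
    simp only [hχ, hH]
    linarith
  rw [deriv_patch hr0] at hsub hsup
  have hdφ : deriv (fun s' => φ (x, s')) t = 2 * N * (t - s) + γ := by
    have h1 : HasDerivAt (fun s' : ℝ => (s' - s) ^ 2) (2 * (t - s)) t := by
      simpa using ((hasDerivAt_id t).sub_const s).fun_pow 2
    have h2 := (((h1.const_add (‖x - y‖ ^ 2)).const_mul N).add_const
      (β * logPenalty (x - x₀))).add ((hasDerivAt_id t).const_mul γ)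
    refine (h2.add_const (u (x, t) - G (x, t))).deriv.trans ?_
    ring
  have hdχ : deriv (fun s' => χ (y, s')) s = 2 * N * (t - s) := by
    have h1 : HasDerivAt (fun s' : ℝ => (t - s') ^ 2) (-(2 * (t - s))) s := by
      simpa using ((hasDerivAt_id s).const_sub t).fun_pow 2
    have h2 := ((h1.const_add (‖x - y‖ ^ 2)).const_mul N).neg
    refine (h2.add_const (v (y, s) + H (y, s))).deriv.trans ?_
    ring
  rw [hdφ] at hsub
  rw [hdχ] at hsup
  set f : EuclideanSpace ℝ (Fin n) → ℝ := fun y' => patch φ u x t r (y', t) with hf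
  set g : EuclideanSpace ℝ (Fin n) → ℝ := fun y' => patch χ v y s r (y', s) with hg
  have hfm : Measurable f := measurable_patch hφc.continuous (hu.1.measurable_slice ht.le)
  have hgm : Measurable g := measurable_patch hχc.continuous (hv.1.measurable_slice hs.le)
  have hfx : f x = u (x, t) := patch_self hφP
  have hgy : g y = v (y, s) := patch_self hχQ
  set q : EuclideanSpace ℝ (Fin n) := (2 * N) • (x - y) with hq
  set l : EuclideanSpace ℝ (Fin n) := logPenaltyGrad (x - x₀) with hl
  have hfin : ∀ z, ‖z‖ < r → f (x + z) - f x - inner ℝ (q + β • l) z = N * ‖z‖ ^ 2 +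
      β * (logPenalty (x - x₀ + z) - logPenalty (x - x₀) - inner ℝ l z) := fun z hz => by
    rw [hfx, hf]
    simp only
    rw [patch_of_lt hr0 hz, hφ, hG, inner_add_left, real_inner_smul_left l, hq,
        real_inner_smul_left]
    simp only
    rw [show x + z - y = (x - y) + z by abel, norm_add_sq_real, add_sub_right_comm x z x₀]
    ring
  have hgin : ∀ z, ‖z‖ < r → g (y + z) - g y - inner ℝ q z = -(N * ‖z‖ ^ 2) := fun z hz => by
    rw [hgy, hg]
    simp only
    rw [patch_of_lt hr0 hz, hχ, hH, hq, real_inner_smul_left]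
    simp only
    rw [show x - (y + z) = (x - y) - z by abel, norm_sub_sq_real (x - y) z]
    ring
  have hfout : ∀ z, r ≤ ‖z‖ → f (x + z) = u (x + z, t) := fun z hz => patch_of_ge hz
  have hgout : ∀ z, r ≤ ‖z‖ → g (y + z) = v (y + z, s) := fun z hz => patch_of_ge hz
  -- Translating both points by `z` cancels the quadratic penalty, whatever `N` is.
  have hfgout : ∀ z, r ≤ ‖z‖ → f (x + z) - f x - (g (y + z) - g y) ≤
      β * (logPenalty (x - x₀ + z) - logPenalty (x - x₀)) := fun z hz => by
    rw [hfout z hz, hgout z hz, hfx, hgy]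
    have := hmax (x + z, t) (y + z, s) ⟨ht.le, htT⟩ ⟨hs.le, hsT⟩
    simp only [doubled, add_sub_add_right_eq_sub, add_sub_right_comm x z x₀] at this
    linarith
  obtain ⟨K, hK⟩ : ∃ K, ∀ z, |incr f x (q + β • l) z| ≤ K * levyWeight ‖z‖ := by
    refine exists_abs_incr_le (B := 2 * C) (C := N + β * (2 * ‖x - x₀‖ + 1)) hr0 hr1
      (fun z hz => ?_) fun z hz => ?_
    · rw [hfout z hz, hfx]
      exact (abs_sub _ _).trans (by linarith [huC (x + z) t ht.le, huC x t ht.le])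
    · rw [hfin z hz]
      have h1 := mul_le_mul_of_nonneg_left (logPenalty_add_sub_le (x - x₀) z) hβ
      have h2 := mul_le_mul_of_nonneg_left
        (neg_le_logPenalty_add_sub (x := x - x₀) (hz.trans_le hr1)) hβ
      have h3 : 0 ≤ N * ‖z‖ ^ 2 := by positivity
      have h4 : 0 ≤ β * (‖x - x₀‖ * ‖z‖ ^ 2) := by positivity
      rw [abs_le]
      constructor <;> linarith
  obtain ⟨K', hK'⟩ : ∃ K, ∀ z, |incr g y q z| ≤ K * levyWeight ‖z‖ := by
    refine exists_abs_incr_le (B := 2 * C) (C := N) hr0 hr1 (fun z hz => ?_) fun z hz => ?_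
    · rw [hgout z hz, hgy]
      exact (abs_sub _ _).trans (by linarith [hvC (y + z) s hs.le, hvC y s hs.le])
    · rw [hgin z hz, abs_neg, abs_of_nonneg (by positivity)]
  -- The term `2Nσ` comes from the two paraboloids in the ball of radius `r`, where `√r = σ`; `4β`
  -- comes from the logarithm beyond the unit ball.
  have hdiff : ∀ z, incr f x (q + β • l) z - incr g y q z ≤
      (2 * N * σ + 4 * β) * levyWeight ‖z‖ := fun z => by
    have hw := levyWeight_nonneg (norm_nonneg z)
    have hNw : 0 ≤ 2 * N * σ * levyWeight ‖z‖ := by positivity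
    have hβw : 0 ≤ β * levyWeight ‖z‖ := by positivity
    rcases lt_or_ge ‖z‖ 1 with h1 | h1
    · have h2 := mul_le_mul_of_nonneg_left (logPenalty_add_sub_le (x - x₀) z) hβ
      have h3 := mul_le_mul_of_nonneg_left (sq_le_levyWeight (norm_nonneg z) h1) hβ
      rw [incr_of_lt h1, incr_of_lt h1]
      rcases lt_or_ge ‖z‖ r with h | h
      · rw [hfin z h, hgin z h]
        have h4 := sq_le_sqrt_mul_levyWeight (norm_nonneg z) h.le h1
        rw [hsqrt] at h4
        have h5 := mul_le_mul_of_nonneg_left h4 hN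
        linarith
      · have h4 := hfgout z h
        rw [inner_add_left, real_inner_smul_left l]
        linarith
    · have h2 := mul_le_mul_of_nonneg_left (logPenalty_add_sub_le_sqrt (x - x₀) z) hβ
      rw [incr_of_ge h1, incr_of_ge h1]
      have h4 := hfgout z (hr1.trans h1)
      rw [levyWeight_of_ge h1] at *
      linarith
  have hle := hsub.trans ((isaacsOp_le_add hb ha_meas ha_symm ha0 ha hfm hgm (by positivity)
    hK hK' hdiff).trans (add_le_add_left hsup _))
  rw [← EReal.coe_add, EReal.coe_le_coe_iff, add_sub_cancel_left, norm_smul,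
    Real.norm_of_nonneg hβ] at hle
  have h5 : |A| * (β * ‖l‖) ≤ |A| * β := by
    gcongr
    exact mul_le_of_le_one_right hβ (norm_logPenaltyGrad_le _)
  linarith

end Comparison

/-! ### Choice of the parameters -/

theorem corollaryl {n : ℕ} {ι κ : Type*}
    (lam Lam A : ℝ) (hlam : 0 < lam) (hLam : lam ≤ Lam)
    (c : ι → κ → ℝ)
    (b : ι → κ → EuclideanSpace ℝ (Fin n)) (hb : ∀ i j, ‖b i j‖ ≤ A)
    (a : ι → κ → EuclideanSpace ℝ (Fin n) → ℝ)
    (ha_meas : ∀ i j, AEMeasurable (a i j) MeasureTheory.volume)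
    (ha_symm : ∀ i j y, a i j y = a i j (-y))
    (ha_ell : ∀ i j y, lam ≤ a i j y ∧ a i j y ≤ Lam)
    (u v : EuclideanSpace ℝ (Fin n) × ℝ → ℝ)
    (hu : IsViscositySubsolution c b a u)
    (hv : IsViscositySupersolution c b a v)
    (hu_bdd : ∃ C : ℝ, ∀ x t, 0 ≤ t → |u (x, t)| ≤ C)
    (hv_bdd : ∃ C : ℝ, ∀ x t, 0 ≤ t → |v (x, t)| ≤ C)
    (h0 : ∀ x, u (x, 0) ≤ v (x, 0)) :
    ∀ x t, 0 ≤ t → u (x, t) ≤ v (x, t) := by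
  intro x₀ T hT
  by_contra! hlt
  have hT0 : 0 < T := hT.lt_of_ne' fun h => (h0 x₀).not_gt (h ▸ hlt)
  obtain ⟨C₁, hC₁⟩ := hu_bdd
  obtain ⟨C₂, hC₂⟩ := hv_bdd
  set δ := u (x₀, T) - v (x₀, T) with hδ
  have hδ0 : 0 < δ := sub_pos.2 hlt
  -- Half of the gap `δ` survives the term `γ t` at time `T`.
  set γ := δ / (2 * T) with hγ
  have hγ0 : 0 < γ := by positivity
  have hγT : γ * T < δ := by
    have : γ * T = δ / 2 := by rw [hγ]; field_simp
    linarith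
  set M := Lam * ∫ z : EuclideanSpace ℝ (Fin n), levyWeight ‖z‖ / ‖z‖ ^ (n + 1) with hM
  have hM0 : 0 ≤ M := mul_nonneg (hlam.le.trans hLam) (integral_nonneg fun z =>
    div_nonneg (levyWeight_nonneg (norm_nonneg z)) (by positivity))
  set β := γ / (4 * (|A| + 4 * M + 1)) with hβ
  have hβ0 : 0 < β := by positivity
  have hβ1 : β * (|A| + 4 * M + 1) = γ / 4 := by rw [hβ]; field_simp
  obtain ⟨N, hN, P, Q, hP, hQ, hmax⟩ := exists_isMax_doubled (C := max C₁ C₂) hu.1 hv.1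
    (fun x t ht => (hC₁ x t ht).trans (le_max_left _ _))
    (fun x t ht => (hC₂ x t ht).trans (le_max_right _ _)) h0 hT hβ0 hγ0.le hγT
  have hN0 : 0 ≤ N := zero_le_one.trans hN
  -- `N` depends on `β` but not on `σ`, so `σ` may be chosen last. The `β` terms and the `σ` term
  -- are then each at most `γ / 4`.
  set σ := min 1 (γ / (4 * (2 * N * M + 1))) with hσ
  have hσ0 : 0 < σ := lt_min one_pos (by positivity)
  have hσ1 : σ * (2 * N * M + 1) ≤ γ / 4 := by
    calc _ ≤ γ / (4 * (2 * N * M + 1)) * (2 * N * M + 1) := by gcongr; exact min_le_right _ _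
      _ = γ / 4 := by field_simp
  have hfinal := le_of_isMax_doubled (C := max C₁ C₂) hb ha_meas ha_symm
    (fun i j y => hlam.le.trans (ha_ell i j y).1) (fun i j y => (ha_ell i j y).2) hu hv
    (fun x t ht => (hC₁ x t ht).trans (le_max_left _ _))
    (fun x t ht => (hC₂ x t ht).trans (le_max_right _ _)) hN0 hβ0.le hσ0 (min_le_left _ _)
    hP hQ hmax
  rw [← hM] at hfinal
  linarith
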